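/- All locally convex spaces are real and Hausdorff. Let $E,F$ be locally convex spaces and let $U\subseteq E$ have dense interior, i.e. $U\subseteq\overline{\operatorname{int}(U)}$. A map $f\colon U\to F$ is $C^0$ if it is continuous, and $C^1$ if it is continuous, the limit $\lim_{h\to 0}\frac{1}{h}\bigl(f(x+hv)-f(x)\bigr)$ exists for all $x\in\operatorname{int}(U)$ and $v\in E$, and the resulting map $\operatorname{int}(U)\times E\to F$ extends to a continuous map $df\colon U\times E\to F$. It is $C^{n+1}$ if it is $C^1$ and $df$ is $C^n$, and smooth if it is $C^n$ for all $n\in\mathbb N_0$. Let $C^\infty(U,F)$ be the vector space of smooth maps $U\to F$, with the initial topology with respect to the maps $f\mapsto d^nf\in C(U\times E^{2^n-1},F)$, $n\in\mathbb N_0$, where $d^0f=f$, $d^{n+1}f=d(d^nf)$ and the spaces of continuous maps carry the compact-open topology. Two locally convex spaces $E$ and $E'$ satisfy the Cartesian closedness principle if for all open sets $U\subseteq E$, $U'\subseteq E'$ and every locally convex space $F$ the assignment $f\mapsto f^\wedge$, $f^\wedge(x)(y)=f(x,y)$, is a well-defined linear isomorphism $$C^\infty(U\times U',F)\to C^\infty(U,C^\infty(U',F)).$$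 **Proposition.** Suppose that $E$ and $E'$ satisfy the Cartesian closedness principle, that $U\subseteq E$ and $U'\subseteq E'$ have dense interior, and that $F$ is locally convex. Then $f\mapsto f^\wedge$, $f^\wedge(x)(y)=f(x,y)$, is a well-defined linear map $$C^\infty(U\times U',F)\to C^\infty(U,C^\infty(U',F)).$$ If, moreover, $E'$ is finite-dimensional, and $U'$ is locally compact or $E$ is metrizable, then this map is a linear isomorphism. -/

import Mathlib

open Set Filter Topology

universe u v w

set_option linter.unusedSectionVars false

noncomputable section

/-- A subset of a topological space whose interior is dense in it. -/
structure DenseIntSet (E : Type u) [TopologicalSpace E] where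
  carrier : Set E
  subset_closure_interior : carrier ⊆ closure (interior carrier)

namespace DenseIntSet

/-- An open set has dense interior. -/
def ofOpen {E : Type u} [TopologicalSpace E] (U : Set E) (hU : IsOpen U) : DenseIntSet E :=
  ⟨U, by rw [hU.interior_eq]; exact subset_closure⟩

/-- The product `U × V` inside `E × E'`. -/
def prod {E : Type u} {E' : Type v} [TopologicalSpace E] [TopologicalSpace E']
    (U : DenseIntSet E) (V : DenseIntSet E') : DenseIntSet (E × E') :=
  ⟨U.carrier ×ˢ V.carrier, by
    rw [interior_prod_eq, closure_prod_eq]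
    exact prod_mono U.subset_closure_interior V.subset_closure_interior⟩

/-- The set `U × E` inside `E × E`. -/
def tangent {E : Type u} [TopologicalSpace E] (U : DenseIntSet E) : DenseIntSet (E × E) :=
  U.prod (ofOpen univ isOpen_univ)

/-- The point `(x, y)` of `U × V`. -/
def pair {E : Type u} {E' : Type v} [TopologicalSpace E] [TopologicalSpace E']
    {U : DenseIntSet E} {V : DenseIntSet E'} (x : U.carrier) (y : V.carrier) :
    (U.prod V).carrier :=
  ⟨((x : E), (y : E')), x.2, y.2⟩

/-- The point `(x, v)` of `U × E`. -/
def tpair {E : Type u} [TopologicalSpace E] {U : DenseIntSet E} (x : U.carrier) (v : E) :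
    U.tangent.carrier :=
  ⟨((x : E), v), x.2, mem_univ v⟩

end DenseIntSet

/-- `f : U → F` is of class `C¹` with differential `df : U × E → F`: both maps are continuous and,
for `x` in the interior of `U` and every direction `v`, the limit of `(f (x + h v) - f x) / h` for
`h → 0` exists and equals `df (x, v)`. In other words, the restriction of `f` to the interior is
`C¹`, and `df` is a continuous extension to `U × E` of the differential of that restriction.
The difference quotient uses the extension of `f` by zero, whose values outside `U` do not
influence the limit because `x` is an interior point. -/
def IsC1With {E : Type u} [AddCommGroup E] [Module ℝ E] [TopologicalSpace E]
    {F : Type v} [AddCommGroup F] [Module ℝ F] [TopologicalSpace F]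
    (U : DenseIntSet E) (f : U.carrier → F) (df : U.tangent.carrier → F) : Prop :=
  Continuous f ∧ Continuous df ∧
    ∀ x : U.carrier, (x : E) ∈ interior U.carrier → ∀ v : E,
      Tendsto (fun h : ℝ => h⁻¹ • (Function.extend Subtype.val f 0 ((x : E) + h • v) - f x))
        (𝓝[≠] 0) (𝓝 (df (DenseIntSet.tpair x v)))

/-- `f : U → F` is of class `C^n`: for `n = 0` it is continuous, and it is `C^(n+1)` if it is `C¹`
and its differential `df : U × E → F` is `C^n`. -/
def IsCn {F : Type v} [AddCommGroup F] [Module ℝ F] [TopologicalSpace F] :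
    (n : ℕ) → {E : Type u} → [AddCommGroup E] → [Module ℝ E] → [TopologicalSpace E] →
      (U : DenseIntSet E) → (U.carrier → F) → Prop
  | 0, _, _, _, _, _, f => Continuous f
  | n + 1, _, _, _, _, U, f => ∃ df, IsC1With U f df ∧ IsCn n U.tangent df

/-- `f : U → F` is smooth, that is, of class `C^n` for every `n`. -/
def IsSmooth {E : Type u} [AddCommGroup E] [Module ℝ E] [TopologicalSpace E]
    {F : Type v} [AddCommGroup F] [Module ℝ F] [TopologicalSpace F]
    (U : DenseIntSet E) (f : U.carrier → F) : Prop :=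
  ∀ n : ℕ, IsCn n U f

section Linear

variable {E : Type u} [AddCommGroup E] [Module ℝ E] [TopologicalSpace E]
  {F : Type v} [AddCommGroup F] [Module ℝ F] [TopologicalSpace F]

theorem extend_eq_of_mem (U : DenseIntSet E) (f : U.carrier → F) {y : E} (hy : y ∈ U.carrier) :
    Function.extend Subtype.val f 0 y = f ⟨y, hy⟩ :=
  Subtype.val_injective.extend_apply f 0 ⟨y, hy⟩

theorem extend_add (U : DenseIntSet E) (f g : U.carrier → F) (y : E) :
    Function.extend Subtype.val (f + g) 0 y =
      Function.extend Subtype.val f 0 y + Function.extend Subtype.val g 0 y := by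
  by_cases hy : y ∈ U.carrier
  · simp [extend_eq_of_mem U _ hy]
  · have : ¬ ∃ a : U.carrier, (a : E) = y := fun ⟨a, ha⟩ => hy (ha ▸ a.2)
    simp [Function.extend_apply' _ _ _ this]

theorem extend_smul (U : DenseIntSet E) (c : ℝ) (f : U.carrier → F) (y : E) :
    Function.extend Subtype.val (c • f) 0 y = c • Function.extend Subtype.val f 0 y := by
  by_cases hy : y ∈ U.carrier
  · simp [extend_eq_of_mem U _ hy]
  · have : ¬ ∃ a : U.carrier, (a : E) = y := fun ⟨a, ha⟩ => hy (ha ▸ a.2)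
    simp [Function.extend_apply' _ _ _ this]

variable [IsTopologicalAddGroup F] [ContinuousSMul ℝ F]

theorem IsC1With.add {U : DenseIntSet E} {f g : U.carrier → F} {df dg : U.tangent.carrier → F}
    (hf : IsC1With U f df) (hg : IsC1With U g dg) : IsC1With U (f + g) (df + dg) := by
  refine ⟨hf.1.add hg.1, hf.2.1.add hg.2.1, fun x hx v => ?_⟩
  refine ((hf.2.2 x hx v).add (hg.2.2 x hx v)).congr fun h => ?_
  rw [extend_add, Pi.add_apply, ← smul_add]
  congr 1
  abel

theorem IsC1With.smul {U : DenseIntSet E} (c : ℝ) {f : U.carrier → F}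
    {df : U.tangent.carrier → F} (hf : IsC1With U f df) : IsC1With U (c • f) (c • df) := by
  refine ⟨hf.1.const_smul c, hf.2.1.const_smul c, fun x hx v => ?_⟩
  refine ((hf.2.2 x hx v).const_smul c).congr fun h => ?_
  rw [extend_smul, Pi.smul_apply, ← smul_sub, smul_comm]

end Linear

theorem IsC1With.unique {E : Type u} [AddCommGroup E] [Module ℝ E] [TopologicalSpace E]
    {F : Type v} [AddCommGroup F] [Module ℝ F] [TopologicalSpace F] [T2Space F]
    {U : DenseIntSet E} {f : U.carrier → F} {d₁ d₂ : U.tangent.carrier → F}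
    (h₁ : IsC1With U f d₁) (h₂ : IsC1With U f d₂) : d₁ = d₂ := by
  have hd : Dense {p : U.tangent.carrier | (p : E × E).1 ∈ interior U.carrier} := by
    rw [Subtype.dense_iff]
    intro p hp
    have h := U.tangent.subset_closure_interior hp
    refine closure_mono ?_ h
    intro q hq
    refine ⟨⟨q, interior_subset hq⟩, ?_, rfl⟩
    have h' : q ∈ interior (U.carrier ×ˢ (univ : Set E)) := hq
    rw [interior_prod_eq] at h'
    exact h'.1
  refine Continuous.ext_on hd h₁.2.1 h₂.2.1 ?_
  intro p hp
  exact tendsto_nhds_unique (h₁.2.2 ⟨(p : E × E).1, p.2.1⟩ hp (p : E × E).2)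
    (h₂.2.2 ⟨(p : E × E).1, p.2.1⟩ hp (p : E × E).2)

theorem IsCn.zero_fun {F : Type v} [AddCommGroup F] [Module ℝ F] [TopologicalSpace F] (n : ℕ) :
    ∀ {E : Type u} [AddCommGroup E] [Module ℝ E] [TopologicalSpace E] (U : DenseIntSet E),
      IsCn n U (0 : U.carrier → F) := by
  induction n with
  | zero => intro E _ _ _ U; exact continuous_const
  | succ n ih =>
    intro E _ _ _ U
    refine ⟨0, ⟨continuous_const, continuous_const, fun x _ v => ?_⟩, ih _⟩
    have h0 : Function.extend (Subtype.val : U.carrier → E) (0 : U.carrier → F) 0 = 0 :=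
      Function.extend_zero _
    simp only [h0, Pi.zero_apply, sub_self, smul_zero]
    exact tendsto_const_nhds

theorem IsCn.add {F : Type v} [AddCommGroup F] [Module ℝ F] [TopologicalSpace F]
    [IsTopologicalAddGroup F] [ContinuousSMul ℝ F] (n : ℕ) :
    ∀ {E : Type u} [AddCommGroup E] [Module ℝ E] [TopologicalSpace E] (U : DenseIntSet E)
      (f g : U.carrier → F), IsCn n U f → IsCn n U g → IsCn n U (f + g) := by
  induction n with
  | zero => intro E _ _ _ U f g hf hg; exact Continuous.add hf hg
  | succ n ih =>
    rintro E _ _ _ U f g ⟨df, hf, hf'⟩ ⟨dg, hg, hg'⟩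
    exact ⟨df + dg, hf.add hg, ih _ _ _ hf' hg'⟩

theorem IsCn.smul {F : Type v} [AddCommGroup F] [Module ℝ F] [TopologicalSpace F]
    [IsTopologicalAddGroup F] [ContinuousSMul ℝ F] (n : ℕ) (c : ℝ) :
    ∀ {E : Type u} [AddCommGroup E] [Module ℝ E] [TopologicalSpace E] (U : DenseIntSet E)
      (f : U.carrier → F), IsCn n U f → IsCn n U (c • f) := by
  induction n with
  | zero => intro E _ _ _ U f hf; exact Continuous.const_smul hf c
  | succ n ih =>
    rintro E _ _ _ U f ⟨df, hf, hf'⟩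
    exact ⟨c • df, hf.smul c, ih _ _ hf'⟩

/-- The smooth maps `U → F` as a linear subspace of all maps. -/
def smoothSubmodule {E : Type u} [AddCommGroup E] [Module ℝ E] [TopologicalSpace E]
    (U : DenseIntSet E) (F : Type v) [AddCommGroup F] [Module ℝ F] [TopologicalSpace F]
    [IsTopologicalAddGroup F] [ContinuousSMul ℝ F] : Submodule ℝ (U.carrier → F) where
  carrier := {f | IsSmooth U f}
  zero_mem' := fun n => IsCn.zero_fun n U
  add_mem' := fun hf hg n => IsCn.add n U _ _ (hf n) (hg n)
  smul_mem' := fun c _ hf n => IsCn.smul n c U _ (hf n)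

/-- The vector space `C^∞(U, F)` of smooth maps. This is a type of its own, so that it does not
carry the topology of pointwise convergence. -/
def SmoothMap {E : Type u} [AddCommGroup E] [Module ℝ E] [TopologicalSpace E]
    (U : DenseIntSet E) (F : Type v) [AddCommGroup F] [Module ℝ F] [TopologicalSpace F]
    [IsTopologicalAddGroup F] [ContinuousSMul ℝ F] : Type (max u v) :=
  ↥(smoothSubmodule U F)

namespace SmoothMap

variable {E : Type u} [AddCommGroup E] [Module ℝ E] [TopologicalSpace E] {U : DenseIntSet E}
  {F : Type v} [AddCommGroup F] [Module ℝ F] [TopologicalSpace F]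
  [IsTopologicalAddGroup F] [ContinuousSMul ℝ F]

instance : AddCommGroup (SmoothMap U F) := inferInstanceAs (AddCommGroup ↥(smoothSubmodule U F))

instance : Module ℝ (SmoothMap U F) := inferInstanceAs (Module ℝ ↥(smoothSubmodule U F))

instance : CoeFun (SmoothMap U F) (fun _ => U.carrier → F) := ⟨fun f => f.1⟩

theorem smooth (f : SmoothMap U F) : IsSmooth U f := f.2

/-- The inclusion of `C^∞(U, F)` into the space `C(U, F)` with the compact-open topology. -/
def toContinuous : SmoothMap U F →ₗ[ℝ] C(U.carrier, F) where
  toFun f := ⟨f, f.smooth 0⟩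
  map_add' _ _ := rfl
  map_smul' _ _ := rfl

theorem exists_differential [T2Space F] (f : SmoothMap U F) :
    ∃ df : SmoothMap U.tangent F, IsC1With U f df := by
  obtain ⟨df, h, -⟩ := f.smooth 1
  refine ⟨⟨df, fun n => ?_⟩, h⟩
  obtain ⟨dg, h', hn⟩ := f.smooth (n + 1)
  rwa [h.unique h']

/-- The differential `d : C^∞(U, F) → C^∞(U × E, F)`. -/
def differential [T2Space F] : SmoothMap U F →ₗ[ℝ] SmoothMap U.tangent F where
  toFun f := f.exists_differential.choose
  map_add' f g := Subtype.ext <| (f + g).exists_differential.choose_spec.unique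
    (f.exists_differential.choose_spec.add g.exists_differential.choose_spec)
  map_smul' c f := Subtype.ext <| (c • f).exists_differential.choose_spec.unique
    (f.exists_differential.choose_spec.smul c)

theorem differential_spec [T2Space F] (f : SmoothMap U F) :
    IsC1With U f (differential f) := f.exists_differential.choose_spec

end SmoothMap

/-- The topology on `C^∞(U, F)` induced by the single map
`f ↦ d^n f ∈ C(U × E^(2^n - 1), F)`, where the target has the compact-open topology. -/
@[reducible]
def smoothTopology {F : Type v} [AddCommGroup F] [Module ℝ F] [TopologicalSpace F]
    [IsTopologicalAddGroup F] [ContinuousSMul ℝ F] [T2Space F] :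
    (n : ℕ) → {E : Type u} → [AddCommGroup E] → [Module ℝ E] → [TopologicalSpace E] →
      (U : DenseIntSet E) → TopologicalSpace (SmoothMap U F)
  | 0, _, _, _, _, _ => TopologicalSpace.induced SmoothMap.toContinuous inferInstance
  | n + 1, _, _, _, _, U => TopologicalSpace.induced SmoothMap.differential
      (smoothTopology n U.tangent)

/-- The topology on `C^∞(U, F)`: the initial topology with respect to all the maps
`f ↦ d^n f ∈ C(U × E^(2^n - 1), F)`, where the targets have the compact-open topology. -/
instance SmoothMap.instTopologicalSpace
    {E : Type u} [AddCommGroup E] [Module ℝ E] [TopologicalSpace E] {U : DenseIntSet E}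
    {F : Type v} [AddCommGroup F] [Module ℝ F] [TopologicalSpace F]
    [IsTopologicalAddGroup F] [ContinuousSMul ℝ F] [T2Space F] :
    TopologicalSpace (SmoothMap U F) :=
  ⨅ n : ℕ, smoothTopology n U

theorem smoothTopology_isTopologicalAddGroup {F : Type v} [AddCommGroup F] [Module ℝ F]
    [TopologicalSpace F] [IsTopologicalAddGroup F] [ContinuousSMul ℝ F] [T2Space F] (n : ℕ) :
    ∀ {E : Type u} [AddCommGroup E] [Module ℝ E] [TopologicalSpace E] (U : DenseIntSet E),
      @IsTopologicalAddGroup (SmoothMap U F) (smoothTopology n U) _ := by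
  induction n with
  | zero => intro E _ _ _ U; exact topologicalAddGroup_induced SmoothMap.toContinuous
  | succ n ih =>
    intro E _ _ _ U
    let := smoothTopology (F := F) n U.tangent
    have := ih U.tangent
    exact topologicalAddGroup_induced SmoothMap.differential

theorem smoothTopology_continuousSMul {F : Type v} [AddCommGroup F] [Module ℝ F]
    [TopologicalSpace F] [IsTopologicalAddGroup F] [ContinuousSMul ℝ F] [T2Space F] (n : ℕ) :
    ∀ {E : Type u} [AddCommGroup E] [Module ℝ E] [TopologicalSpace E] (U : DenseIntSet E),
      @ContinuousSMul ℝ (SmoothMap U F) _ _ (smoothTopology n U) := by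
  induction n with
  | zero => intro E _ _ _ U; exact continuousSMul_induced SmoothMap.toContinuous
  | succ n ih =>
    intro E _ _ _ U
    let := smoothTopology (F := F) n U.tangent
    have := ih U.tangent
    exact continuousSMul_induced SmoothMap.differential

namespace SmoothMap

variable {E : Type u} [AddCommGroup E] [Module ℝ E] [TopologicalSpace E] {U : DenseIntSet E}
  {F : Type v} [AddCommGroup F] [Module ℝ F] [TopologicalSpace F]
  [IsTopologicalAddGroup F] [ContinuousSMul ℝ F] [T2Space F]

instance instIsTopologicalAddGroup : IsTopologicalAddGroup (SmoothMap U F) :=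
  topologicalAddGroup_iInf fun n => smoothTopology_isTopologicalAddGroup n U

instance instContinuousSMul : ContinuousSMul ℝ (SmoothMap U F) :=
  continuousSMul_iInf fun n => smoothTopology_continuousSMul n U

end SmoothMap

/-- The linear map `Φ` is the canonical map `f ↦ f^∧`, `f^∧(x)(y) = f(x, y)`. -/
def IsCurrying {E : Type u} [AddCommGroup E] [Module ℝ E] [TopologicalSpace E]
    {E' : Type v} [AddCommGroup E'] [Module ℝ E'] [TopologicalSpace E']
    {F : Type w} [AddCommGroup F] [Module ℝ F] [TopologicalSpace F]
    [IsTopologicalAddGroup F] [ContinuousSMul ℝ F] [T2Space F]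
    {U : DenseIntSet E} {U' : DenseIntSet E'}
    (Φ : SmoothMap (U.prod U') F →ₗ[ℝ] SmoothMap U (SmoothMap U' F)) : Prop :=
  ∀ (f : SmoothMap (U.prod U') F) (x : U.carrier) (y : U'.carrier),
    Φ f x y = f (DenseIntSet.pair x y)

/-- The Cartesian closedness principle for `E` and `E'`: for all open `U ⊆ E` and `U' ⊆ E'` and
every (Hausdorff) locally convex space `F`, the rule `f^∧(x)(y) = f(x, y)` gives a well-defined
linear isomorphism from `C^∞(U × U', F)` onto `C^∞(U, C^∞(U', F))`. -/
def CartesianClosedness (E : Type u) [AddCommGroup E] [Module ℝ E] [TopologicalSpace E]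
    (E' : Type v) [AddCommGroup E'] [Module ℝ E'] [TopologicalSpace E'] : Prop :=
  ∀ (U : Set E) (hU : IsOpen U) (U' : Set E') (hU' : IsOpen U')
    (F : Type w) [AddCommGroup F] [Module ℝ F] [TopologicalSpace F]
    [IsTopologicalAddGroup F] [ContinuousSMul ℝ F] [LocallyConvexSpace ℝ F] [T2Space F],
    ∃ Φ : SmoothMap ((DenseIntSet.ofOpen U hU).prod (DenseIntSet.ofOpen U' hU')) F →ₗ[ℝ]
        SmoothMap (DenseIntSet.ofOpen U hU) (SmoothMap (DenseIntSet.ofOpen U' hU') F),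
      IsCurrying Φ ∧ Function.Bijective Φ

end

/-! The idea is to run the differential calculus directly on sets with dense interior. Since `F` is
locally convex, Hahn-Banach reduces the mean value theorem to real functions: a difference quotient
lies in every closed convex set containing the derivatives. Hence difference quotients with a
parameter converge jointly (`tendsto_quotient_prod`), and derivatives survive pointwise limits of
curves (`hasCurveDeriv_of_tendsto`). The latter yields partial differentials at boundary points, as
limits from the interior.

Well-definedness of currying: the differential of `f^∧` is `(d₁f)^∧`, where `d₁f` is the partial
differential in the first variable, again a smooth map on a product. So it suffices to treat `C¹`,
with convergence in `C^∞(U', F)` tested on each `d^n`. For `n = 0` joint convergence is uniform on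
compact sets; raising `n` exchanges the two partial differentials (`differential_slice_tangentFst`).

Bijectivity: injectivity is pointwise. For surjectivity, either alternative hypothesis makes
evaluation jointly continuous along `g`. The uncurried map is then `C¹`, and its differential is the
sum of the uncurried `dg` and the uncurried `d ∘ g`. Both have the form of the original problem on
larger sets, which closes the induction (`IsCn.uncurry`). -/

/-- The curve `c` in a topological vector space has derivative `l` at the time `t`. -/
def HasCurveDeriv {F : Type w} [AddCommGroup F] [Module ℝ F] [TopologicalSpace F]
    (c : ℝ → F) (l : F) (t : ℝ) : Prop :=
  Tendsto (fun h : ℝ => h⁻¹ • (c (t + h) - c t)) (𝓝[≠] 0) (𝓝 l)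

/-! ### Mean value theorem and limits of curves in locally convex spaces. -/

section Curve

variable {F : Type w} [AddCommGroup F] [Module ℝ F] [TopologicalSpace F]
  [IsTopologicalAddGroup F] [ContinuousSMul ℝ F]

theorem HasCurveDeriv.hasDerivAt {c : ℝ → F} {l : F} {t : ℝ} (h : HasCurveDeriv c l t)
    (φ : F →L[ℝ] ℝ) : HasDerivAt (fun s => φ (c s)) (φ l) t := by
  rw [hasDerivAt_iff_tendsto_slope_zero]
  refine ((φ.continuous.tendsto l).comp h).congr fun s => ?_
  simp

theorem HasCurveDeriv.sub {c₁ c₂ : ℝ → F} {l₁ l₂ : F} {t : ℝ} (h₁ : HasCurveDeriv c₁ l₁ t)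
    (h₂ : HasCurveDeriv c₂ l₂ t) : HasCurveDeriv (fun s => c₁ s - c₂ s) (l₁ - l₂) t := by
  refine (Tendsto.sub h₁ h₂).congr fun h => ?_
  rw [← smul_sub]
  exact congrArg _ (sub_sub_sub_comm _ _ _ _)

theorem HasCurveDeriv.const_smul {c : ℝ → F} {l : F} {t : ℝ} (h : HasCurveDeriv c l t) (a : ℝ) :
    HasCurveDeriv (fun s => a • c s) (a • l) t := by
  refine (Tendsto.const_smul h a).congr fun h => ?_
  rw [smul_comm, smul_sub]

/-- The mean value theorem: a difference quotient lies in each closed convex set that contains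
the derivatives. -/
theorem HasCurveDeriv.quotient_mem [LocallyConvexSpace ℝ F] {c c' : ℝ → F} {C : Set F}
    (hC : Convex ℝ C) (hC' : IsClosed C) {h : ℝ} (h0 : h ≠ 0)
    (hc : ∀ s ∈ uIcc 0 h, HasCurveDeriv c (c' s) s ∧ c' s ∈ C) :
    h⁻¹ • (c h - c 0) ∈ C := by
  by_contra hn
  -- A functional separating the quotient from `C` contradicts the real mean value theorem.
  obtain ⟨φ, u, hu, hu'⟩ := geometric_hahn_banach_closed_point hC hC' hn
  have hmem : ∀ s ∈ Icc (0 : ℝ) 1, s * h ∈ uIcc 0 h := by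
    intro s hs
    rw [mem_uIcc]
    rcases lt_or_gt_of_ne h0 with hh | hh
    · right; constructor <;> nlinarith [hs.1, hs.2]
    · left; constructor <;> nlinarith [hs.1, hs.2]
  -- Rescaling time to `[0, 1]` treats both signs of `h` at once.
  have hd : ∀ s ∈ Icc (0 : ℝ) 1,
      HasDerivAt (fun s => φ (c (s * h))) (φ (c' (s * h)) * h) s := fun s hs =>
    HasDerivAt.comp (h₂ := fun r => φ (c r)) (h := fun r => r * h) s
      ((hc _ (hmem s hs)).1.hasDerivAt φ) (hasDerivAt_mul_const h)
  obtain ⟨s, hs, hs'⟩ := exists_hasDerivAt_eq_slope (fun s => φ (c (s * h)))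
    (fun s => φ (c' (s * h)) * h) zero_lt_one
    (fun s hs => (hd s hs).continuousAt.continuousWithinAt)
    (fun s hs => hd s (Ioo_subset_Icc_self hs))
  have h1 := hu _ (hc _ (hmem s (Ioo_subset_Icc_self hs))).2
  simp only [one_mul, zero_mul, sub_zero, div_one] at hs'
  have h2 : φ (h⁻¹ • (c h - c 0)) = φ (c' (s * h)) := by
    rw [map_smul, map_sub, ← hs', smul_eq_mul]
    field_simp
  rw [h2] at hu'
  exact lt_asymm h1 hu'

/-- Shrinking to a closed neighbourhood first leaves room for the closure of a convex one. Convexity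
and closedness are what the mean value theorem needs; closedness also lets limits stay inside. -/
theorem exists_closed_convex_nhds_subset [LocallyConvexSpace ℝ F] {l : F} {O : Set F}
    (hO : O ∈ 𝓝 l) : ∃ C ∈ 𝓝 l, IsClosed C ∧ Convex ℝ C ∧ C ⊆ O := by
  obtain ⟨C₁, h₁, h₁', h₁''⟩ := exists_mem_nhds_isClosed_subset hO
  obtain ⟨C₂, ⟨h₂, h₂'⟩, h₂''⟩ := (LocallyConvexSpace.convex_basis (𝕜 := ℝ) l).mem_iff.1 h₁
  exact ⟨closure C₂, mem_of_superset h₂ subset_closure, isClosed_closure, h₂'.closure,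
    (closure_minimal h₂'' h₁').trans h₁''⟩

/-- Difference quotients of a family of curves converge jointly if the derivatives do. -/
theorem tendsto_quotient_prod [LocallyConvexSpace ℝ F] {T : Type*} {m : Filter T}
    {c c' : T → ℝ → F} {l : F}
    (hc : ∀ᶠ p : T × ℝ in m ×ˢ 𝓝 0, HasCurveDeriv (c p.1) (c' p.1 p.2) p.2)
    (hc' : Tendsto (fun p : T × ℝ => c' p.1 p.2) (m ×ˢ 𝓝 0) (𝓝 l)) :
    Tendsto (fun p : T × ℝ => p.2⁻¹ • (c p.1 p.2 - c p.1 0)) (m ×ˢ 𝓝[≠] 0) (𝓝 l) := by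
  intro O hO
  obtain ⟨C, hC, hCc, hCv, hCO⟩ := exists_closed_convex_nhds_subset hO
  -- A product neighbourhood with an interval around `0` contains, with each time `y`, all times
  -- between `0` and `y`, as the mean value theorem requires.
  obtain ⟨pa, ha, pb, hb, hab⟩ := eventually_prod_iff.1 (hc.and (hc'.eventually_mem hC))
  obtain ⟨ε, hε, hb'⟩ := Metric.eventually_nhds_iff.1 hb
  have hb2 : ∀ᶠ s : ℝ in 𝓝[≠] 0, s ≠ 0 ∧ |s| < ε := by
    refine (eventually_mem_nhdsWithin).and (mem_nhdsWithin_of_mem_nhds ?_)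
    filter_upwards [Metric.ball_mem_nhds (0 : ℝ) hε] with s hs
    simpa using hs
  rw [mem_map]
  refine mem_of_superset (ha.prod_mk hb2) ?_
  rintro ⟨x, y⟩ ⟨hx, hy⟩
  refine hCO (HasCurveDeriv.quotient_mem (c' := c' x) hCv hCc hy.1 fun s hs => hab hx (hb' ?_))
  · rw [Real.dist_eq, sub_zero]
    refine lt_of_le_of_lt ?_ hy.2
    rcases mem_uIcc.1 hs with h | h
    · rw [abs_of_nonneg h.1]; exact h.2.trans (le_abs_self y)
    · rw [abs_of_nonpos h.2]; exact (neg_le_neg h.1).trans (neg_le_abs y)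

/-- A pointwise limit of curves is differentiable if the derivatives converge. -/
theorem hasCurveDeriv_of_tendsto [LocallyConvexSpace ℝ F] {T : Type*} {m : Filter T} [m.NeBot]
    {c c' : T → ℝ → F} {c₀ : ℝ → F} {l : F}
    (hc : ∀ᶠ p : T × ℝ in m ×ˢ 𝓝 0, HasCurveDeriv (c p.1) (c' p.1 p.2) p.2)
    (hc' : Tendsto (fun p : T × ℝ => c' p.1 p.2) (m ×ˢ 𝓝 0) (𝓝 l))
    (h₀ : ∀ᶠ s in 𝓝 0, Tendsto (fun τ => c τ s) m (𝓝 (c₀ s))) :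
    HasCurveDeriv c₀ l 0 := by
  intro O hO
  obtain ⟨C, hC, hCc, hCv, hCO⟩ := exists_closed_convex_nhds_subset hO
  obtain ⟨pa, ha, pb, hb, hab⟩ := eventually_prod_iff.1
    ((tendsto_quotient_prod hc hc').eventually_mem hC)
  change ∀ᶠ s in 𝓝[≠] 0, _ ∈ O
  filter_upwards [hb, mem_nhdsWithin_of_mem_nhds h₀] with s hs hs'
  -- For fixed `s` the quotients of `c τ` lie in `C` eventually, so their limit in `τ` does too.
  refine hCO (hCc.mem_of_tendsto (b := m) (f := fun τ => s⁻¹ • (c τ s - c τ 0)) ?_ ?_)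
  · rw [zero_add]
    exact (hs'.sub h₀.self_of_nhds).const_smul _
  · filter_upwards [ha] with τ hτ using hab hτ hs

end Curve

/-! ### Chain rules with continuous linear maps. -/

theorem DenseIntSet.interior_prod {E : Type u} {E' : Type v} [TopologicalSpace E]
    [TopologicalSpace E'] (U : DenseIntSet E) (V : DenseIntSet E') :
    interior (U.prod V).carrier = interior U.carrier ×ˢ interior V.carrier :=
  interior_prod_eq U.carrier V.carrier

theorem DenseIntSet.mem_interior_tangent {E : Type u} [TopologicalSpace E] {U : DenseIntSet E}
    {p : E × E} : p ∈ interior U.tangent.carrier ↔ p.1 ∈ interior U.carrier := by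
  rw [DenseIntSet.tangent, DenseIntSet.interior_prod]
  simp [DenseIntSet.ofOpen]

section Basic

variable {E : Type u} [AddCommGroup E] [Module ℝ E] [TopologicalSpace E]
  {E₂ : Type v} [AddCommGroup E₂] [Module ℝ E₂] [TopologicalSpace E₂]
  {F : Type w} [AddCommGroup F] [Module ℝ F] [TopologicalSpace F]

theorem continuousOn_extend {U : DenseIntSet E} {f : U.carrier → F} (hf : Continuous f) :
    ContinuousOn (Function.extend Subtype.val f 0) U.carrier := by
  rw [continuousOn_iff_continuous_domRestrict]
  refine hf.congr fun x => ?_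
  exact (extend_eq_of_mem U f x.2).symm

theorem IsC1With.hasCurveDeriv {U : DenseIntSet E} {f : U.carrier → F}
    {df : U.tangent.carrier → F} (hf : IsC1With U f df) {x v : E} {t : ℝ}
    (hx : x + t • v ∈ interior U.carrier) :
    HasCurveDeriv (fun s => Function.extend Subtype.val f 0 (x + s • v))
      (df (DenseIntSet.tpair ⟨x + t • v, interior_subset hx⟩ v)) t := by
  refine (hf.2.2 ⟨x + t • v, interior_subset hx⟩ hx v).congr fun h => ?_
  simp only [extend_eq_of_mem U f (interior_subset hx), add_smul, add_assoc]

theorem IsC1With.hasCurveDeriv_zero {U : DenseIntSet E} {f : U.carrier → F}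
    {df : U.tangent.carrier → F} (hf : IsC1With U f df) {x : U.carrier}
    (hx : (x : E) ∈ interior U.carrier) (v : E) :
    HasCurveDeriv (fun s => Function.extend Subtype.val f 0 ((x : E) + s • v))
      (df (DenseIntSet.tpair x v)) 0 := by
  have hx' : (x : E) + (0 : ℝ) • v ∈ interior U.carrier := by simpa using hx
  convert hf.hasCurveDeriv hx'
  simp

theorem eventually_add_smul_mem [ContinuousAdd E] [ContinuousSMul ℝ E] {S : Set E} {x : E}
    (hx : x ∈ interior S) (v : E) : ∀ᶠ h : ℝ in 𝓝 0, x + h • v ∈ interior S := by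
  have hc : Continuous fun h : ℝ => x + h • v := by fun_prop
  exact hc.continuousAt.eventually_mem (isOpen_interior.mem_nhds (by simpa using hx))

/-- The way back from curves to the limit in `IsC1With`: near time `0` the line stays in the
interior, so the value of the extension outside `U` plays no role. -/
theorem HasCurveDeriv.tendsto_extend [ContinuousAdd E] [ContinuousSMul ℝ E] {U : DenseIntSet E}
    {f : U.carrier → F} {x : U.carrier} (hx : (x : E) ∈ interior U.carrier) {v : E}
    {c : ℝ → F} {l : F} (hc : HasCurveDeriv c l 0)
    (hcf : ∀ (h : ℝ) (hh : (x : E) + h • v ∈ U.carrier), c h = f ⟨_, hh⟩) :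
    Tendsto (fun h : ℝ => h⁻¹ • (Function.extend Subtype.val f 0 ((x : E) + h • v) - f x))
        (𝓝[≠] 0) (𝓝 l) := by
  refine hc.congr' ?_
  filter_upwards [mem_nhdsWithin_of_mem_nhds (eventually_add_smul_mem hx v)] with h hh
  have h0 : c 0 = f x := by
    rw [hcf 0 (by simp)]
    congr 2
    simp
  rw [extend_eq_of_mem U f (interior_subset hh), zero_add, h0, hcf h (interior_subset hh)]

/-- Interiors must be mapped to interiors because the derivative limit is only given there, and a
linear map need not be open. -/
theorem IsC1With.comp [ContinuousAdd E] [ContinuousSMul ℝ E] {U : DenseIntSet E}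
    {U₂ : DenseIntSet E₂} {f : U₂.carrier → F} {df : U₂.tangent.carrier → F}
    (hf : IsC1With U₂ f df) (A : E →L[ℝ] E₂) (hA : MapsTo A U.carrier U₂.carrier)
    (hA' : MapsTo A (interior U.carrier) (interior U₂.carrier)) :
    IsC1With U (fun x => f ⟨A x, hA x.2⟩)
      (fun p => df ⟨(A p.1.1, A p.1.2), hA p.2.1, mem_univ _⟩) := by
  refine ⟨hf.1.comp (by fun_prop), hf.2.1.comp ?_, fun x hx v => ?_⟩
  · exact Continuous.subtype_mk (by fun_prop) _
  · refine (hf.hasCurveDeriv_zero (x := ⟨A x, hA x.2⟩) (hA' hx) (A v)).tendsto_extend hx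
      fun h hh => ?_
    have : A x + h • A v = A (x + h • v) := by simp
    simp only [this]
    exact extend_eq_of_mem _ _ (hA hh)

theorem IsC1With.map {U : DenseIntSet E} {f : U.carrier → E₂} {df : U.tangent.carrier → E₂}
    (hf : IsC1With U f df) (L : E₂ →L[ℝ] F) :
    IsC1With U (fun x => L (f x)) (fun p => L (df p)) := by
  refine ⟨L.continuous.comp hf.1, L.continuous.comp hf.2.1, fun x hx v => ?_⟩
  refine ((L.continuous.tendsto _).comp (hf.2.2 x hx v)).congr fun h => ?_
  rw [Function.comp, map_smul, map_sub]
  congr 2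
  by_cases hy : (x : E) + h • v ∈ U.carrier
  · simp [extend_eq_of_mem U _ hy]
  · have : ¬ ∃ a : U.carrier, (a : E) = (x : E) + h • v := fun ⟨a, ha⟩ => hy (ha ▸ a.2)
    simp [Function.extend_apply' _ _ _ this]

end Basic

/-- The differential is `df` composed with `A × A`, again a linear map respecting interiors, so the
induction closes. -/
theorem IsCn.comp {F : Type w} [AddCommGroup F] [Module ℝ F] [TopologicalSpace F] (n : ℕ) :
    ∀ {E : Type u} [AddCommGroup E] [Module ℝ E] [TopologicalSpace E]
      [IsTopologicalAddGroup E] [ContinuousSMul ℝ E]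
      {E₂ : Type v} [AddCommGroup E₂] [Module ℝ E₂] [TopologicalSpace E₂]
      {U : DenseIntSet E} {U₂ : DenseIntSet E₂} {f : U₂.carrier → F} (_ : IsCn n U₂ f)
      (A : E →L[ℝ] E₂) (hA : MapsTo A U.carrier U₂.carrier)
      (_ : MapsTo A (interior U.carrier) (interior U₂.carrier)),
      IsCn n U (fun x => f ⟨A x, hA x.2⟩) := by
  induction n with
  | zero =>
    intro E _ _ _ _ _ E₂ _ _ _ U U₂ f hf A hA hA'
    exact Continuous.comp (g := f) hf (by fun_prop)
  | succ n ih =>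
    rintro E _ _ _ _ _ E₂ _ _ _ U U₂ f ⟨df, hf, hf'⟩ A hA hA'
    refine ⟨_, hf.comp A hA hA', ih hf' (A.prodMap A)
      (fun p (hp : p ∈ U.tangent.carrier) => ⟨hA hp.1, mem_univ _⟩) ?_⟩
    intro p hp
    rw [DenseIntSet.mem_interior_tangent] at hp ⊢
    exact hA' hp

theorem IsCn.map {F : Type v} [AddCommGroup F] [Module ℝ F] [TopologicalSpace F]
    {F₂ : Type w} [AddCommGroup F₂] [Module ℝ F₂] [TopologicalSpace F₂] (L : F →L[ℝ] F₂) (n : ℕ) :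
    ∀ {E : Type u} [AddCommGroup E] [Module ℝ E] [TopologicalSpace E]
      {U : DenseIntSet E} {f : U.carrier → F} (_ : IsCn n U f), IsCn n U (fun x => L (f x)) := by
  induction n with
  | zero =>
    intro E _ _ _ U f hf
    exact L.continuous.comp hf
  | succ n ih =>
    rintro E _ _ _ U f ⟨df, hf, hf'⟩
    exact ⟨_, hf.map L, ih hf'⟩

theorem IsCn.of_succ {F : Type w} [AddCommGroup F] [Module ℝ F] [TopologicalSpace F] (n : ℕ) :
    ∀ {E : Type u} [AddCommGroup E] [Module ℝ E] [TopologicalSpace E]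
      {U : DenseIntSet E} {f : U.carrier → F} (_ : IsCn (n + 1) U f), IsCn n U f := by
  induction n with
  | zero =>
    rintro E _ _ _ U f ⟨df, hf, -⟩
    exact hf.1
  | succ n ih =>
    rintro E _ _ _ U f ⟨df, hf, hf'⟩
    exact ⟨df, hf, ih hf'⟩

/-! ### Partial differentials up to the boundary. -/

section Partial

variable {E : Type u} [AddCommGroup E] [Module ℝ E] [TopologicalSpace E]
  [IsTopologicalAddGroup E] [ContinuousSMul ℝ E]
  {E' : Type v} [AddCommGroup E'] [Module ℝ E'] [TopologicalSpace E']
  [IsTopologicalAddGroup E'] [ContinuousSMul ℝ E']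
  {F : Type w} [AddCommGroup F] [Module ℝ F] [TopologicalSpace F]
  [IsTopologicalAddGroup F] [ContinuousSMul ℝ F] [LocallyConvexSpace ℝ F]
  {U : DenseIntSet E} {U' : DenseIntSet E'}

/-- The partial differential in the second variable, also at boundary points of the first set. -/
theorem IsC1With.partial_snd {f : (U.prod U').carrier → F} {df : (U.prod U').tangent.carrier → F}
    (hf : IsC1With (U.prod U') f df) (x : U.carrier) :
    IsC1With U' (fun y => f (DenseIntSet.pair x y))
      (fun q => df ⟨(((x : E), q.1.1), ((0 : E), q.1.2)), ⟨x.2, q.2.1⟩, mem_univ _⟩) := by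
  refine ⟨hf.1.comp ?_, hf.2.1.comp ?_, fun y hy w => ?_⟩
  · exact Continuous.subtype_mk (by fun_prop) _
  · exact Continuous.subtype_mk (by fun_prop) _
  have hne : (𝓝[interior U.carrier] (x : E)).NeBot :=
    mem_closure_iff_nhdsWithin_neBot.1 (U.subset_closure_interior x.2)
  have hmem : ∀ᶠ p : E × ℝ in 𝓝[interior U.carrier] (x : E) ×ˢ 𝓝 0,
      p.1 ∈ interior U.carrier ∧ (y : E') + p.2 • w ∈ interior U'.carrier :=
    (eventually_mem_nhdsWithin (a := (x : E))).prod_mk (eventually_add_smul_mem hy w)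
  -- If `x` is a boundary point, the line through `(x, y)` misses the interior of the product. It is
  -- approximated by parallel lines through `(s, y)` with `s` in the interior of `U`; continuity of
  -- `df` makes their derivatives converge.
  have key := hasCurveDeriv_of_tendsto (m := 𝓝[interior U.carrier] (x : E))
    (c := fun s t => Function.extend Subtype.val f 0 (s, (y : E') + t • w))
    (c' := fun s t => Function.extend Subtype.val df 0 ((s, (y : E') + t • w), ((0 : E), w)))
    (c₀ := fun t => Function.extend Subtype.val f 0 ((x : E), (y : E') + t • w))
    (l := df ⟨(((x : E), (y : E')), ((0 : E), w)), ⟨x.2, y.2⟩, mem_univ _⟩) ?_ ?_ ?_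
  · exact key.tendsto_extend hy fun h hh => extend_eq_of_mem (U.prod U') f ⟨x.2, hh⟩
  · filter_upwards [hmem] with p hp
    have hp' : (p.1, (y : E')) + p.2 • ((0 : E), w) ∈ interior (U.prod U').carrier := by
      rw [DenseIntSet.interior_prod]
      simpa using hp
    have := hf.hasCurveDeriv hp'
    simp only [Prod.smul_mk, Prod.mk_add_mk, smul_zero, add_zero] at this hp'
    convert this using 1
    exact extend_eq_of_mem _ df ⟨interior_subset hp', mem_univ _⟩
  · have h1 := continuousOn_extend hf.2.1 (((x : E), (y : E')), ((0 : E), w))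
      ⟨⟨x.2, y.2⟩, mem_univ _⟩
    rw [ContinuousWithinAt, extend_eq_of_mem _ df ⟨⟨x.2, y.2⟩, mem_univ _⟩] at h1
    refine h1.comp (tendsto_nhdsWithin_iff.2 ⟨?_, ?_⟩)
    · have hc : Continuous fun p : E × ℝ => ((p.1, (y : E') + p.2 • w), ((0 : E), w)) := by
        fun_prop
      have h2 := hc.tendsto ((x : E), 0)
      simp only [zero_smul, add_zero, nhds_prod_eq] at h2
      rw [nhds_prod_eq, nhds_prod_eq, nhds_prod_eq]
      exact h2.mono_left (prod_mono_left _ nhdsWithin_le_nhds)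
    · filter_upwards [hmem] with p hp
      exact ⟨⟨interior_subset hp.1, interior_subset hp.2⟩, mem_univ _⟩
  · filter_upwards [eventually_add_smul_mem hy w] with t ht
    have h1 := continuousOn_extend hf.1 ((x : E), (y : E') + t • w) ⟨x.2, interior_subset ht⟩
    refine Tendsto.comp h1 (tendsto_nhdsWithin_iff.2 ⟨?_, ?_⟩)
    · have hc : Continuous fun s : E => (s, (y : E') + t • w) := by fun_prop
      exact (hc.tendsto _).mono_left nhdsWithin_le_nhds
    · filter_upwards [eventually_mem_nhdsWithin] with s hs
      exact ⟨interior_subset hs, interior_subset ht⟩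

/-- The partial differential in the first variable, also at boundary points of the second set. -/
theorem IsC1With.partial_fst {f : (U.prod U').carrier → F} {df : (U.prod U').tangent.carrier → F}
    (hf : IsC1With (U.prod U') f df) (y : U'.carrier) :
    IsC1With U (fun x => f (DenseIntSet.pair x y))
      (fun q => df ⟨((q.1.1, (y : E')), (q.1.2, (0 : E'))), ⟨q.2.1, y.2⟩, mem_univ _⟩) := by
  -- Swapping the two factors reduces this to `partial_snd`.
  have hA : MapsTo ((ContinuousLinearMap.snd ℝ E' E).prod (ContinuousLinearMap.fst ℝ E' E))
      (U'.prod U).carrier (U.prod U').carrier := fun p hp => ⟨hp.2, hp.1⟩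
  refine (hf.comp _ hA fun p hp => ?_).partial_snd y
  rw [DenseIntSet.interior_prod] at hp ⊢
  exact ⟨hp.2, hp.1⟩

end Partial

/-- The canonical reordering of coordinates turns a map on the tangent set of `U × U'` into one on
the product of the tangent sets. -/
theorem IsCn.tangent_prod {E : Type u} [AddCommGroup E] [Module ℝ E] [TopologicalSpace E]
    [IsTopologicalAddGroup E] [ContinuousSMul ℝ E]
    {E' : Type v} [AddCommGroup E'] [Module ℝ E'] [TopologicalSpace E']
    [IsTopologicalAddGroup E'] [ContinuousSMul ℝ E']
    {F : Type w} [AddCommGroup F] [Module ℝ F] [TopologicalSpace F]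
    {U : DenseIntSet E} {U' : DenseIntSet E'} {n : ℕ}
    {df : (U.prod U').tangent.carrier → F} (h : IsCn n (U.prod U').tangent df) :
    IsCn n (U.tangent.prod U'.tangent) (fun p =>
      df ⟨((p.1.1.1, p.1.2.1), (p.1.1.2, p.1.2.2)), ⟨p.2.1.1, p.2.2.1⟩, mem_univ _⟩) := by
  let A : (E × E) × (E' × E') →L[ℝ] (E × E') × (E × E') :=
    ⟨{ toFun := fun p => ((p.1.1, p.2.1), (p.1.2, p.2.2))
       map_add' := fun _ _ => rfl
       map_smul' := fun _ _ => rfl }, by fun_prop⟩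
  refine h.comp n A (fun p (hp : p ∈ (U.tangent.prod U'.tangent).carrier) =>
    ⟨⟨hp.1.1, hp.2.1⟩, mem_univ _⟩) fun p hp => ?_
  rw [DenseIntSet.interior_prod] at hp
  rw [DenseIntSet.mem_interior_tangent, DenseIntSet.interior_prod]
  exact ⟨DenseIntSet.mem_interior_tangent.1 hp.1, DenseIntSet.mem_interior_tangent.1 hp.2⟩

/-- The partial differential in the first variable is as smooth as the whole differential. -/
theorem IsCn.tangent_fst {E : Type u} [AddCommGroup E] [Module ℝ E] [TopologicalSpace E]
    [IsTopologicalAddGroup E] [ContinuousSMul ℝ E]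
    {E' : Type v} [AddCommGroup E'] [Module ℝ E'] [TopologicalSpace E']
    [IsTopologicalAddGroup E'] [ContinuousSMul ℝ E']
    {F : Type w} [AddCommGroup F] [Module ℝ F] [TopologicalSpace F]
    {U : DenseIntSet E} {U' : DenseIntSet E'} {n : ℕ}
    {df : (U.prod U').tangent.carrier → F} (h : IsCn n (U.prod U').tangent df) :
    IsCn n (U.tangent.prod U') (fun p =>
      df ⟨((p.1.1.1, p.1.2), (p.1.1.2, 0)), ⟨p.2.1.1, p.2.2⟩, mem_univ _⟩) := by
  let A : (E × E) × E' →L[ℝ] (E × E') × (E × E') :=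
    ⟨{ toFun := fun p => ((p.1.1, p.2), (p.1.2, 0))
       map_add' := fun _ _ => by simp
       map_smul' := fun _ _ => by simp }, by fun_prop⟩
  refine h.comp n A (fun p (hp : p ∈ (U.tangent.prod U').carrier) =>
    ⟨⟨hp.1.1, hp.2⟩, mem_univ _⟩) fun p hp => ?_
  rw [DenseIntSet.interior_prod] at hp
  rw [DenseIntSet.mem_interior_tangent, DenseIntSet.interior_prod]
  exact ⟨DenseIntSet.mem_interior_tangent.1 hp.1, hp.2⟩

/-- The differential of a slice at `x` is the slice of the reordered differential at `(x, 0)`, so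
the induction runs over all products. -/
theorem IsCn.slice {F : Type w} [AddCommGroup F] [Module ℝ F] [TopologicalSpace F]
    [IsTopologicalAddGroup F] [ContinuousSMul ℝ F] [LocallyConvexSpace ℝ F] (n : ℕ) :
    ∀ {E : Type u} [AddCommGroup E] [Module ℝ E] [TopologicalSpace E]
      [IsTopologicalAddGroup E] [ContinuousSMul ℝ E]
      {E' : Type v} [AddCommGroup E'] [Module ℝ E'] [TopologicalSpace E']
      [IsTopologicalAddGroup E'] [ContinuousSMul ℝ E']
      {U : DenseIntSet E} {U' : DenseIntSet E'} {f : (U.prod U').carrier → F}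
      (_ : IsCn n (U.prod U') f) (x : U.carrier),
      IsCn n U' (fun y => f (DenseIntSet.pair x y)) := by
  induction n with
  | zero =>
    intro E _ _ _ _ _ E' _ _ _ _ _ U U' f hf x
    exact Continuous.comp (g := f) hf (Continuous.subtype_mk (by fun_prop) _)
  | succ n ih =>
    rintro E _ _ _ _ _ E' _ _ _ _ _ U U' f ⟨df, hf, hf'⟩ x
    exact ⟨_, hf.partial_snd x, ih hf'.tangent_prod (DenseIntSet.tpair x 0)⟩

/-! ### The curried map and its continuity. -/

namespace SmoothMap

variable {E : Type u} [AddCommGroup E] [Module ℝ E] [TopologicalSpace E]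
  [IsTopologicalAddGroup E] [ContinuousSMul ℝ E]
  {E' : Type v} [AddCommGroup E'] [Module ℝ E'] [TopologicalSpace E']
  [IsTopologicalAddGroup E'] [ContinuousSMul ℝ E']
  {F : Type w} [AddCommGroup F] [Module ℝ F] [TopologicalSpace F]
  [IsTopologicalAddGroup F] [ContinuousSMul ℝ F] [LocallyConvexSpace ℝ F]
  {U : DenseIntSet E} {U' : DenseIntSet E'}

/-- The smooth map `f (x, ·)`. -/
def slice (f : SmoothMap (U.prod U') F) (x : U.carrier) : SmoothMap U' F :=
  ⟨fun y => f (DenseIntSet.pair x y), fun n => (f.smooth n).slice n x⟩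

variable [T2Space F]

/-- The differential of `f`, as a map on the product of the tangent sets. -/
noncomputable def tangentProd (f : SmoothMap (U.prod U') F) :
    SmoothMap (U.tangent.prod U'.tangent) F :=
  ⟨_, fun n => ((differential f).smooth n).tangent_prod⟩

/-- The partial differential `((x, v), y) ↦ df ((x, y), (v, 0))`. -/
noncomputable def tangentFst (f : SmoothMap (U.prod U') F) : SmoothMap (U.tangent.prod U') F :=
  ⟨_, fun n => ((differential f).smooth n).tangent_fst⟩

theorem differential_eq {f : SmoothMap U F} {df : SmoothMap U.tangent F}
    (h : IsC1With U f df) : differential f = df :=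
  Subtype.ext (f.differential_spec.unique h)

theorem differential_slice (f : SmoothMap (U.prod U') F) (x : U.carrier) :
    differential (f.slice x) = f.tangentProd.slice (DenseIntSet.tpair x 0) :=
  differential_eq (f.differential_spec.partial_snd x)

/-- Currying is always continuous into the compact-open topology, and `differential_slice` lowers
the level `n`. -/
theorem continuous_slice_smoothTopology {F : Type w} [AddCommGroup F] [Module ℝ F]
    [TopologicalSpace F] [IsTopologicalAddGroup F] [ContinuousSMul ℝ F] [LocallyConvexSpace ℝ F]
    [T2Space F] (n : ℕ) :
    ∀ {E : Type u} [AddCommGroup E] [Module ℝ E] [TopologicalSpace E]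
      [IsTopologicalAddGroup E] [ContinuousSMul ℝ E]
      {E' : Type v} [AddCommGroup E'] [Module ℝ E'] [TopologicalSpace E']
      [IsTopologicalAddGroup E'] [ContinuousSMul ℝ E']
      {U : DenseIntSet E} {U' : DenseIntSet E'} (f : SmoothMap (U.prod U') F),
      @Continuous _ _ _ (smoothTopology n U') f.slice := by
  induction n with
  | zero =>
    intro E _ _ _ _ _ E' _ _ _ _ _ U U' f
    refine continuous_induced_rng.2 ?_
    refine ContinuousMap.continuous_of_continuous_uncurry _ ?_
    exact Continuous.comp (g := f.1) (f.smooth 0) (Continuous.subtype_mk (by fun_prop) _)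
  | succ n ih =>
    intro E _ _ _ _ _ E' _ _ _ _ _ U U' f
    let := smoothTopology (F := F) n U'.tangent
    refine continuous_induced_rng.2 ?_
    have h : SmoothMap.differential ∘ f.slice =
        f.tangentProd.slice ∘ fun x : U.carrier => DenseIntSet.tpair x 0 :=
      funext fun x => f.differential_slice x
    rw [h]
    exact (ih f.tangentProd).comp (Continuous.subtype_mk (by fun_prop) _)

theorem continuous_slice (f : SmoothMap (U.prod U') F) : Continuous f.slice :=
  continuous_iInf_rng.2 fun n => continuous_slice_smoothTopology n f

end SmoothMap

/-! ### Joint convergence of partial difference quotients. -/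

section Joint

variable {E : Type u} [AddCommGroup E] [Module ℝ E] [TopologicalSpace E]
  [IsTopologicalAddGroup E] [ContinuousSMul ℝ E]
  {E' : Type v} [AddCommGroup E'] [Module ℝ E'] [TopologicalSpace E']
  [IsTopologicalAddGroup E'] [ContinuousSMul ℝ E']
  {F : Type w} [AddCommGroup F] [Module ℝ F] [TopologicalSpace F]
  [IsTopologicalAddGroup F] [ContinuousSMul ℝ F] [LocallyConvexSpace ℝ F]
  {U : DenseIntSet E} {U' : DenseIntSet E'}

theorem extend_pair (f : (U.prod U').carrier → F) (x : E) (y : U'.carrier) :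
    Function.extend Subtype.val (fun x : U.carrier => f (DenseIntSet.pair x y)) 0 x =
      Function.extend Subtype.val f 0 (x, (y : E')) := by
  by_cases hx : x ∈ U.carrier
  · rw [extend_eq_of_mem U _ hx, extend_eq_of_mem (U.prod U') f ⟨hx, y.2⟩]
    rfl
  · rw [Function.extend_apply', Function.extend_apply']
    · rfl
    · rintro ⟨a, ha⟩
      exact hx (by simpa [ha] using a.2.1)
    · rintro ⟨a, rfl⟩
      exact hx a.2

/-- If `f` is differentiable in the first variable with jointly continuous differential, then the
difference quotients in that variable converge locally uniformly in the second one. -/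
theorem tendsto_quotient_of_partial {f : (U.prod U').carrier → F}
    {D : (U.tangent.prod U').carrier → F} (hD : Continuous D)
    (hf : ∀ y : U'.carrier, IsC1With U (fun x => f (DenseIntSet.pair x y))
      (fun q => D (DenseIntSet.pair q y))) {x : U.carrier}
    (hx : (x : E) ∈ interior U.carrier) (v : E) (y : U'.carrier) :
    Tendsto (fun p : E' × ℝ => p.2⁻¹ • (Function.extend Subtype.val f 0 ((x : E) + p.2 • v, p.1) -
        Function.extend Subtype.val f 0 ((x : E), p.1)))
      (𝓝[U'.carrier] (y : E') ×ˢ 𝓝[≠] 0)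
      (𝓝 (D (DenseIntSet.pair (DenseIntSet.tpair x v) y))) := by
  have hmem : ∀ᶠ p : E' × ℝ in 𝓝[U'.carrier] (y : E') ×ˢ 𝓝 0,
      p.1 ∈ U'.carrier ∧ (x : E) + p.2 • v ∈ interior U.carrier :=
    (eventually_mem_nhdsWithin (a := (y : E'))).prod_mk (eventually_add_smul_mem hx v)
  -- The second variable is the parameter of the family of curves; it tends to `y` within `U'`.
  have key := tendsto_quotient_prod (m := 𝓝[U'.carrier] (y : E'))
    (c := fun y t => Function.extend Subtype.val f 0 ((x : E) + t • v, y))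
    (c' := fun y t => Function.extend Subtype.val D 0 (((x : E) + t • v, v), y))
    (l := D (DenseIntSet.pair (DenseIntSet.tpair x v) y)) ?_ ?_
  · simpa using key
  · filter_upwards [hmem] with p hp
    have := (hf ⟨p.1, hp.1⟩).hasCurveDeriv hp.2
    simp only [extend_pair] at this
    convert this using 1
    exact extend_eq_of_mem _ D ⟨⟨interior_subset hp.2, mem_univ _⟩, hp.1⟩
  · have hxy : (((x : E), v), (y : E')) ∈ (U.tangent.prod U').carrier :=
      ⟨⟨x.2, mem_univ _⟩, y.2⟩
    have h1 := continuousOn_extend hD _ hxy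
    rw [ContinuousWithinAt, extend_eq_of_mem _ D hxy] at h1
    refine h1.comp (tendsto_nhdsWithin_iff.2 ⟨?_, ?_⟩)
    · have hc : Continuous fun p : E' × ℝ => (((x : E) + p.2 • v, v), p.1) := by
        fun_prop
      have h2 := hc.tendsto ((y : E'), 0)
      simp only [zero_smul, add_zero, nhds_prod_eq] at h2
      rw [nhds_prod_eq, nhds_prod_eq]
      exact h2.mono_left (prod_mono_left _ nhdsWithin_le_nhds)
    · filter_upwards [hmem] with p hp
      exact ⟨⟨interior_subset hp.2, mem_univ _⟩, hp.1⟩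

theorem IsC1With.tendsto_quotient_fst {f : (U.prod U').carrier → F}
    {df : (U.prod U').tangent.carrier → F} (hf : IsC1With (U.prod U') f df) {x : U.carrier}
    (hx : (x : E) ∈ interior U.carrier) (v : E) (y : U'.carrier) :
    Tendsto (fun p : E' × ℝ => p.2⁻¹ • (Function.extend Subtype.val f 0 ((x : E) + p.2 • v, p.1) -
        Function.extend Subtype.val f 0 ((x : E), p.1)))
      (𝓝[U'.carrier] (y : E') ×ˢ 𝓝[≠] 0)
      (𝓝 (df ⟨(((x : E), (y : E')), (v, (0 : E'))), ⟨x.2, y.2⟩, mem_univ _⟩)) :=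
  tendsto_quotient_of_partial (D := fun p : (U.tangent.prod U').carrier =>
      df ⟨((p.1.1.1, p.1.2), (p.1.1.2, 0)), ⟨p.2.1.1, p.2.2⟩, mem_univ _⟩)
    (hf.2.1.comp (Continuous.subtype_mk (by fun_prop) _)) hf.partial_fst hx v y

end Joint

/-! ### Symmetry of mixed differentials and smoothness of the curried map. -/

namespace SmoothMap

section Schwarz

variable {E : Type u} [AddCommGroup E] [Module ℝ E] [TopologicalSpace E]
  [IsTopologicalAddGroup E] [ContinuousSMul ℝ E]
  {E' : Type v} [AddCommGroup E'] [Module ℝ E'] [TopologicalSpace E']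
  [IsTopologicalAddGroup E'] [ContinuousSMul ℝ E']
  {F : Type w} [AddCommGroup F] [Module ℝ F] [TopologicalSpace F]
  [IsTopologicalAddGroup F] [ContinuousSMul ℝ F] [LocallyConvexSpace ℝ F] [T2Space F]
  {U : DenseIntSet E} {U' : DenseIntSet E'}

/-- Partial differentials in the first and the second variable commute. -/
theorem differential_slice_tangentFst (f : SmoothMap (U.prod U') F) {x : U.carrier}
    (hx : (x : E) ∈ interior U.carrier) (v : E) :
    differential (f.tangentFst.slice (DenseIntSet.tpair x v)) =
      f.tangentProd.tangentFst.slice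
        (DenseIntSet.tpair (U := U.tangent) (DenseIntSet.tpair x 0) (v, 0)) := by
  refine differential_eq ⟨SmoothMap.smooth _ 0, SmoothMap.smooth _ 0, fun y hy w => ?_⟩
  have hxv := eventually_add_smul_mem hx v
  have hyw := eventually_add_smul_mem hy w
  -- The parameter `s` is the step of the difference quotient in the first variable. As `s` tends to
  -- `0`, these quotients tend to the partial differential, and their derivatives along `w`, which
  -- are quotients of `tangentProd`, converge jointly.
  have key := hasCurveDeriv_of_tendsto (m := 𝓝[≠] (0 : ℝ))
    (c := fun s t => s⁻¹ • (Function.extend Subtype.val f 0 ((x : E) + s • v, (y : E') + t • w) -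
      Function.extend Subtype.val f 0 ((x : E), (y : E') + t • w)))
    (c' := fun s t => s⁻¹ • (Function.extend Subtype.val f.tangentProd 0
        (((x : E), (0 : E)) + s • (v, (0 : E)), ((y : E') + t • w, w)) -
      Function.extend Subtype.val f.tangentProd 0
        (((x : E), (0 : E)), ((y : E') + t • w, w))))
    (c₀ := fun t => Function.extend Subtype.val
      (f.tangentFst.slice (DenseIntSet.tpair x v)) 0 ((y : E') + t • w))
    (l := f.tangentProd.tangentFst.slice
        (DenseIntSet.tpair (U := U.tangent) (DenseIntSet.tpair x 0) (v, 0))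
        (DenseIntSet.tpair y w)) ?_ ?_ ?_
  · exact key.tendsto_extend hy fun h hh => extend_eq_of_mem U' _ hh
  · filter_upwards [(hxv.filter_mono nhdsWithin_le_nhds).prod_mk hyw] with p hp
    have hderiv : ∀ z ∈ interior U.carrier,
        HasCurveDeriv (fun t => Function.extend Subtype.val f 0 (z, (y : E') + t • w))
          (Function.extend Subtype.val f.tangentProd 0 ((z, 0), ((y : E') + p.2 • w, w))) p.2 := by
      intro z hz
      have hp' : (z, (y : E')) + p.2 • ((0 : E), w) ∈ interior (U.prod U').carrier := by
        rw [DenseIntSet.interior_prod]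
        simpa using ⟨hz, hp.2⟩
      have h1 := f.differential_spec.hasCurveDeriv hp'
      have h2 : ((z, (0 : E)), ((y : E') + p.2 • w, w)) ∈
          (U.tangent.prod U'.tangent).carrier :=
        ⟨⟨interior_subset hz, mem_univ _⟩, ⟨interior_subset hp.2, mem_univ _⟩⟩
      rw [extend_eq_of_mem _ _ h2]
      simp only [Prod.smul_mk, Prod.mk_add_mk, smul_zero, add_zero] at h1
      exact h1
    have h1 := ((hderiv _ hp.1).sub (hderiv _ hx)).const_smul p.1⁻¹
    convert h1 using 6 <;> simp
  · have hx' : ((DenseIntSet.tpair x 0 : U.tangent.carrier) : E × E) ∈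
        interior U.tangent.carrier := DenseIntSet.mem_interior_tangent.2 hx
    have h1 := f.tangentProd.differential_spec.tendsto_quotient_fst hx' (v, (0 : E))
      (DenseIntSet.tpair y w)
    have h2 : Tendsto (fun p : ℝ × ℝ => (((y : E') + p.2 • w, w), p.1)) (𝓝[≠] 0 ×ˢ 𝓝 0)
        (𝓝[U'.tangent.carrier] ((y : E'), w) ×ˢ 𝓝[≠] 0) := by
      refine Tendsto.prodMk (tendsto_nhdsWithin_iff.2 ⟨?_, ?_⟩) tendsto_fst
      · have hc : Continuous fun t : ℝ => ((y : E') + t • w, w) := by fun_prop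
        have h3 := hc.tendsto 0
        simp only [zero_smul, add_zero] at h3
        exact h3.comp tendsto_snd
      · filter_upwards [tendsto_snd.eventually hyw] with p hp
        exact ⟨interior_subset hp, mem_univ _⟩
    exact h1.comp h2
  · filter_upwards [hyw] with t ht
    rw [extend_eq_of_mem U' _ (interior_subset ht)]
    have h1 := (f.differential_spec.partial_fst
      ⟨(y : E') + t • w, interior_subset ht⟩).hasCurveDeriv_zero hx v
    simp only [extend_pair] at h1
    simp only [HasCurveDeriv, zero_add, zero_smul, add_zero] at h1
    exact h1

end Schwarz

/-- Applying `d` to the quotients of `f.slice` gives those of `f.tangentProd.slice` at `(x, 0)` in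
direction `(v, 0)`, and symmetry of mixed differentials identifies the limit. -/
theorem tendsto_quotient_slice_smoothTopology {F : Type w} [AddCommGroup F] [Module ℝ F]
    [TopologicalSpace F] [IsTopologicalAddGroup F] [ContinuousSMul ℝ F] [LocallyConvexSpace ℝ F]
    [T2Space F] (n : ℕ) :
    ∀ {E : Type u} [AddCommGroup E] [Module ℝ E] [TopologicalSpace E]
      [IsTopologicalAddGroup E] [ContinuousSMul ℝ E]
      {E' : Type v} [AddCommGroup E'] [Module ℝ E'] [TopologicalSpace E']
      [IsTopologicalAddGroup E'] [ContinuousSMul ℝ E']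
      {U : DenseIntSet E} {U' : DenseIntSet E'} (f : SmoothMap (U.prod U') F) {x : U.carrier}
      (_ : (x : E) ∈ interior U.carrier) (v : E),
      Tendsto (fun h : ℝ =>
          h⁻¹ • (Function.extend Subtype.val f.slice 0 ((x : E) + h • v) - f.slice x)) (𝓝[≠] 0)
        (@nhds _ (smoothTopology n U') (f.tangentFst.slice (DenseIntSet.tpair x v))) := by
  induction n with
  | zero =>
    intro E _ _ _ _ _ E' _ _ _ _ _ U U' f x hx v
    rw [nhds_induced, tendsto_comap_iff, ContinuousMap.tendsto_nhds_compactOpen]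
    intro K hK O hO hKO
    have h1 : ∀ y ∈ K, ∀ᶠ p : ℝ × U'.carrier in 𝓝[≠] 0 ×ˢ 𝓝 y,
        p.1⁻¹ • (Function.extend Subtype.val f 0 ((x : E) + p.1 • v, (p.2 : E')) -
          Function.extend Subtype.val f 0 ((x : E), (p.2 : E'))) ∈ O := by
      intro y hy
      have h2 := f.differential_spec.tendsto_quotient_fst hx v y
      have h3 : Tendsto (fun p : ℝ × U'.carrier => ((p.2 : E'), p.1)) (𝓝[≠] 0 ×ˢ 𝓝 y)
          (𝓝[U'.carrier] (y : E') ×ˢ 𝓝[≠] 0) := by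
        refine Tendsto.prodMk (Tendsto.comp ?_ tendsto_snd) tendsto_fst
        exact tendsto_nhdsWithin_iff.2
          ⟨continuous_subtype_val.tendsto y, Eventually.of_forall fun y => y.2⟩
      exact (h2.comp h3).eventually_mem (hO.mem_nhds (hKO hy))
    -- Compactness of `K` turns joint convergence at each of its points into one bound on the step
    -- size.
    have h4 := (hK.mem_prod_nhdsSet_of_forall h1)
    filter_upwards [(show ∀ᶠ p in _, _ from h4).curry,
      mem_nhdsWithin_of_mem_nhds (eventually_add_smul_mem hx v)] with h hh hh' y hy
    have h5 := hh.self_of_nhdsSet y hy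
    rw [extend_eq_of_mem _ _ (show (_, _) ∈ (U.prod U').carrier from ⟨interior_subset hh', y.2⟩),
      extend_eq_of_mem _ _ (show (_, _) ∈ (U.prod U').carrier from ⟨x.2, y.2⟩)] at h5
    rw [Function.comp, extend_eq_of_mem _ _ (interior_subset hh')]
    exact h5
  | succ n ih =>
    intro E _ _ _ _ _ E' _ _ _ _ _ U U' f x hx v
    let := smoothTopology (F := F) n U'.tangent
    have hx' : ((DenseIntSet.tpair x 0 : U.tangent.carrier) : E × E) ∈
        interior U.tangent.carrier := DenseIntSet.mem_interior_tangent.2 hx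
    rw [nhds_induced, tendsto_comap_iff, f.differential_slice_tangentFst hx v]
    refine (ih f.tangentProd hx' (v, (0 : E))).congr' ?_
    filter_upwards [mem_nhdsWithin_of_mem_nhds (eventually_add_smul_mem hx v)] with h hh
    have h1 : ((DenseIntSet.tpair x 0 : U.tangent.carrier) : E × E) + h • (v, (0 : E)) =
        ((x : E) + h • v, 0) := by simp [DenseIntSet.tpair]
    rw [h1, extend_eq_of_mem U.tangent _ ⟨interior_subset hh, mem_univ _⟩, Function.comp,
      extend_eq_of_mem _ _ (interior_subset hh), map_smul, map_sub, differential_slice,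
      differential_slice]
    rfl

theorem isC1With_slice {E : Type u} [AddCommGroup E] [Module ℝ E] [TopologicalSpace E]
    [IsTopologicalAddGroup E] [ContinuousSMul ℝ E]
    {E' : Type v} [AddCommGroup E'] [Module ℝ E'] [TopologicalSpace E']
    [IsTopologicalAddGroup E'] [ContinuousSMul ℝ E']
    {F : Type w} [AddCommGroup F] [Module ℝ F] [TopologicalSpace F]
    [IsTopologicalAddGroup F] [ContinuousSMul ℝ F] [LocallyConvexSpace ℝ F] [T2Space F]
    {U : DenseIntSet E} {U' : DenseIntSet E'} (f : SmoothMap (U.prod U') F) :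
    IsC1With U f.slice f.tangentFst.slice := by
  refine ⟨f.continuous_slice, f.tangentFst.continuous_slice, fun x hx v => ?_⟩
  rw [nhds_iInf, tendsto_iInf]
  exact fun n => tendsto_quotient_slice_smoothTopology n f hx v

theorem isCn_slice {E' : Type v} [AddCommGroup E'] [Module ℝ E'] [TopologicalSpace E']
    [IsTopologicalAddGroup E'] [ContinuousSMul ℝ E']
    {F : Type w} [AddCommGroup F] [Module ℝ F] [TopologicalSpace F]
    [IsTopologicalAddGroup F] [ContinuousSMul ℝ F] [LocallyConvexSpace ℝ F] [T2Space F]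
    {U' : DenseIntSet E'} (n : ℕ) :
    ∀ {E : Type u} [AddCommGroup E] [Module ℝ E] [TopologicalSpace E]
      [IsTopologicalAddGroup E] [ContinuousSMul ℝ E] {U : DenseIntSet E}
      (f : SmoothMap (U.prod U') F), IsCn n U f.slice := by
  induction n with
  | zero =>
    intro E _ _ _ _ _ U f
    exact f.continuous_slice
  | succ n ih =>
    intro E _ _ _ _ _ U f
    exact ⟨_, f.isC1With_slice, ih f.tangentFst⟩

/-- The canonical map `f ↦ f^∧`, `f^∧(x)(y) = f(x, y)`. -/
def curry {E : Type u} [AddCommGroup E] [Module ℝ E] [TopologicalSpace E]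
    [IsTopologicalAddGroup E] [ContinuousSMul ℝ E]
    {E' : Type v} [AddCommGroup E'] [Module ℝ E'] [TopologicalSpace E']
    [IsTopologicalAddGroup E'] [ContinuousSMul ℝ E']
    {F : Type w} [AddCommGroup F] [Module ℝ F] [TopologicalSpace F]
    [IsTopologicalAddGroup F] [ContinuousSMul ℝ F] [LocallyConvexSpace ℝ F] [T2Space F]
    {U : DenseIntSet E} {U' : DenseIntSet E'} :
    SmoothMap (U.prod U') F →ₗ[ℝ] SmoothMap U (SmoothMap U' F) where
  toFun f := ⟨f.slice, fun n => f.isCn_slice n⟩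
  map_add' _ _ := rfl
  map_smul' _ _ := rfl

end SmoothMap

/-! ### Joint continuity of evaluation. -/

/-- A convergent sequence together with its limit is a compact set `K`, and evaluation on `C(K, Z)`
is continuous even if `Y` is not locally compact. -/
theorem continuous_uncurry_of_sequentialSpace {X Y Z : Type*} [TopologicalSpace X]
    [TopologicalSpace Y] [T2Space Y] [TopologicalSpace Z] [SequentialSpace (X × Y)]
    {g : X → C(Y, Z)} (hg : Continuous g) : Continuous fun p : X × Y => g p.1 p.2 := by
  refine SeqContinuous.continuous fun s p hs => ?_
  have h1 : Tendsto (fun n => (s n).1) atTop (𝓝 p.1) := (continuous_fst.tendsto p).comp hs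
  have h2 : Tendsto (fun n => (s n).2) atTop (𝓝 p.2) := (continuous_snd.tendsto p).comp hs
  let K : Set Y := insert p.2 (range fun n => (s n).2)
  have : CompactSpace K := isCompact_iff_compactSpace.1 h2.isCompact_insert_range
  let k : ℕ → K := fun n => ⟨(s n).2, mem_insert_of_mem _ ⟨n, rfl⟩⟩
  let k₀ : K := ⟨p.2, mem_insert _ _⟩
  have hk : Tendsto k atTop (𝓝 k₀) := tendsto_subtype_rng.2 h2
  have hr : Continuous fun q : X × K => (g q.1).restrict K q.2 :=
    continuous_eval.comp (((ContinuousMap.continuous_restrict K).comp hg).prodMap continuous_id)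
  have h3 := (hr.tendsto (p.1, k₀)).comp (h1.prodMk_nhds hk)
  exact h3

theorem continuous_uncurry_of_locallyCompact_or_metrizable {E : Type u} [TopologicalSpace E]
    {E' : Type v} [AddCommGroup E'] [Module ℝ E'] [TopologicalSpace E']
    [IsTopologicalAddGroup E'] [ContinuousSMul ℝ E'] [T2Space E'] [FiniteDimensional ℝ E']
    {F : Type w} [TopologicalSpace F] {U : Set E} {U' : Set E'}
    (h : LocallyCompactSpace U' ∨ TopologicalSpace.MetrizableSpace E) {g : U → C(U', F)}
    (hg : Continuous g) : Continuous fun p : U × U' => g p.1 p.2 := by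
  rcases h with h | h
  · exact ContinuousMap.continuous_uncurry_of_continuous ⟨g, hg⟩
  · have : TopologicalSpace.MetrizableSpace E' :=
      (toEuclidean (E := E')).toHomeomorph.isEmbedding.metrizableSpace
    exact continuous_uncurry_of_sequentialSpace hg

namespace SmoothMap

variable {E : Type u} [AddCommGroup E] [Module ℝ E] [TopologicalSpace E] {U : DenseIntSet E}
  {F : Type v} [AddCommGroup F] [Module ℝ F] [TopologicalSpace F]
  [IsTopologicalAddGroup F] [ContinuousSMul ℝ F] [T2Space F]

theorem continuous_toContinuous : Continuous (toContinuous : SmoothMap U F →ₗ[ℝ] C(U.carrier, F)) :=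
  continuous_iInf_dom (i := 0) continuous_induced_dom

/-- The differential as a continuous linear map. -/
noncomputable def differentialCLM : SmoothMap U F →L[ℝ] SmoothMap U.tangent F where
  toLinearMap := differential
  cont := by
    -- Level `n` on the target pulls back to level `n + 1` on the source by definition.
    refine continuous_iInf_rng.2 fun n => continuous_iInf_dom (i := n + 1) ?_
    let := smoothTopology (F := F) n U.tangent
    exact continuous_induced_dom

/-- Evaluation at a point as a continuous linear map. -/
noncomputable def evalCLM (x : U.carrier) : SmoothMap U F →L[ℝ] F where
  toFun f := f x
  map_add' _ _ := rfl
  map_smul' _ _ := rfl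
  cont := (continuous_eval_const x).comp continuous_toContinuous

end SmoothMap

/-! ### Uncurrying. -/

section Uncurry

variable {E : Type u} [AddCommGroup E] [Module ℝ E] [TopologicalSpace E]
  [IsTopologicalAddGroup E] [ContinuousSMul ℝ E]
  {E' : Type v} [AddCommGroup E'] [Module ℝ E'] [TopologicalSpace E']
  [IsTopologicalAddGroup E'] [ContinuousSMul ℝ E'] [T2Space E'] [FiniteDimensional ℝ E']
  {F : Type w} [AddCommGroup F] [Module ℝ F] [TopologicalSpace F]
  [IsTopologicalAddGroup F] [ContinuousSMul ℝ F] [LocallyConvexSpace ℝ F] [T2Space F]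
  {U : DenseIntSet E} {U' : DenseIntSet E'}

theorem continuous_uncurry_smoothMap
    (h : LocallyCompactSpace U'.carrier ∨ TopologicalSpace.MetrizableSpace E)
    {g : U.carrier → SmoothMap U' F} (hg : Continuous g) :
    Continuous fun p : U.carrier × U'.carrier => g p.1 p.2 :=
  continuous_uncurry_of_locallyCompact_or_metrizable h
    (SmoothMap.continuous_toContinuous.comp hg)

/-- Lets the induction replace `U'` by `U' × E'`: the new factor `E'` is locally compact, being
finite-dimensional. -/
theorem locallyCompactSpace_tangent_or_metrizableSpace
    (h : LocallyCompactSpace U'.carrier ∨ TopologicalSpace.MetrizableSpace E) :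
    LocallyCompactSpace U'.tangent.carrier ∨ TopologicalSpace.MetrizableSpace E := by
  refine h.imp_left fun (_ : LocallyCompactSpace U'.carrier) => ?_
  have : LocallyCompactSpace E' := .of_finiteDimensional_of_complete ℝ E'
  have : LocallyCompactSpace (univ : Set E') :=
    isClosed_univ.isClosedEmbedding_subtypeVal.locallyCompactSpace
  exact (Homeomorph.Set.prod U'.carrier univ).isClosedEmbedding.locallyCompactSpace

/-- The increment is split at `(x, y + s w)`: the first part yields `dg`, the second the
differential of the fixed smooth map `g x`. -/
theorem IsC1With.uncurry
    (h : LocallyCompactSpace U'.carrier ∨ TopologicalSpace.MetrizableSpace E)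
    {g : U.carrier → SmoothMap U' F} {dg : U.tangent.carrier → SmoothMap U' F}
    (hg : IsC1With U g dg) :
    IsC1With (U.prod U') (fun p => g ⟨p.1.1, p.2.1⟩ ⟨p.1.2, p.2.2⟩)
      (fun p => dg ⟨(p.1.1.1, p.1.2.1), p.2.1.1, mem_univ _⟩ ⟨p.1.1.2, p.2.1.2⟩ +
        SmoothMap.differential (g ⟨p.1.1.1, p.2.1.1⟩) ⟨(p.1.1.2, p.1.2.2), p.2.1.2, mem_univ _⟩) := by
  have hdg : Continuous fun p : U.tangent.carrier × U'.carrier => dg p.1 p.2 :=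
    continuous_uncurry_smoothMap (h.imp_right fun (_ : TopologicalSpace.MetrizableSpace E) =>
      inferInstanceAs (TopologicalSpace.MetrizableSpace (E × E))) hg.2.1
  have hgd : Continuous fun p : U.carrier × U'.tangent.carrier =>
      SmoothMap.differential (g p.1) p.2 :=
    continuous_uncurry_smoothMap (locallyCompactSpace_tangent_or_metrizableSpace h)
      (SmoothMap.differentialCLM.continuous.comp hg.1)
  refine ⟨?_, ?_, ?_⟩
  · exact (continuous_uncurry_smoothMap h hg.1).comp (Continuous.prodMk
      (Continuous.subtype_mk (by fun_prop) _) (Continuous.subtype_mk (by fun_prop) _))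
  · exact (hdg.comp (Continuous.prodMk
      (Continuous.subtype_mk (by fun_prop) _) (Continuous.subtype_mk (by fun_prop) _))).add
      (hgd.comp (Continuous.prodMk
      (Continuous.subtype_mk (by fun_prop) _) (Continuous.subtype_mk (by fun_prop) _)))
  rintro ⟨⟨x, y⟩, hx₀, hy₀⟩ hxy ⟨v, w⟩
  rw [DenseIntSet.interior_prod] at hxy
  have hxv := eventually_add_smul_mem hxy.1 v
  have hyw := eventually_add_smul_mem hxy.2 w
  have hyw' : Tendsto (fun s : ℝ => y + s • w) (𝓝[≠] 0) (𝓝[U'.carrier] y) := by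
    refine tendsto_nhdsWithin_iff.2 ⟨?_, ?_⟩
    · have hc : Continuous fun t : ℝ => y + t • w := by fun_prop
      have h3 := hc.tendsto 0
      simp only [zero_smul, add_zero] at h3
      exact h3.mono_left nhdsWithin_le_nhds
    · filter_upwards [mem_nhdsWithin_of_mem_nhds hyw] with s hs using interior_subset hs
  -- The second variable moves with `s`, so convergence for each fixed `y` would not suffice; the
  -- joint limit is taken along `(y + s w, s)`.
  have h1 : Tendsto (fun s : ℝ => s⁻¹ • (Function.extend Subtype.val
        (fun p : (U.prod U').carrier => g ⟨p.1.1, p.2.1⟩ ⟨p.1.2, p.2.2⟩) 0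
        (x + s • v, y + s • w) - Function.extend Subtype.val
        (fun p : (U.prod U').carrier => g ⟨p.1.1, p.2.1⟩ ⟨p.1.2, p.2.2⟩) 0 (x, y + s • w)))
      (𝓝[≠] 0) (𝓝 (dg (DenseIntSet.tpair ⟨x, hx₀⟩ v) ⟨y, hy₀⟩)) :=
    (tendsto_quotient_of_partial
      (f := fun p : (U.prod U').carrier => g ⟨p.1.1, p.2.1⟩ ⟨p.1.2, p.2.2⟩)
      (D := fun p : (U.tangent.prod U').carrier => dg ⟨p.1.1, p.2.1⟩ ⟨p.1.2, p.2.2⟩)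
      (hdg.comp (Continuous.prodMk (Continuous.subtype_mk (by fun_prop) _)
        (Continuous.subtype_mk (by fun_prop) _)))
      (fun η => hg.map (SmoothMap.evalCLM η)) (x := ⟨x, hx₀⟩) hxy.1 v ⟨y, hy₀⟩).comp
      (hyw'.prodMk tendsto_id)
  have h2 := (SmoothMap.differential_spec (g ⟨x, hx₀⟩)).2.2 ⟨y, hy₀⟩ hxy.2 w
  refine (h1.add h2).congr' ?_
  filter_upwards [mem_nhdsWithin_of_mem_nhds hxv, mem_nhdsWithin_of_mem_nhds hyw] with s hs hs'
  have hm : (x, y + s • w) ∈ (U.prod U').carrier := ⟨hx₀, interior_subset hs'⟩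
  rw [extend_eq_of_mem _ _ hm, extend_eq_of_mem _ _ (interior_subset hs'), ← smul_add,
    sub_add_sub_cancel]
  rfl

end Uncurry

/-- Both summands of the differential are uncurried `C^n` maps, composed with a linear reordering of
coordinates: `dg` for `U × E` and `U'`, and `d ∘ g` for `U` and `U' × E'`. -/
theorem IsCn.uncurry {F : Type w} [AddCommGroup F] [Module ℝ F] [TopologicalSpace F]
    [IsTopologicalAddGroup F] [ContinuousSMul ℝ F] [LocallyConvexSpace ℝ F] [T2Space F] (n : ℕ) :
    ∀ {E : Type u} [AddCommGroup E] [Module ℝ E] [TopologicalSpace E]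
      [IsTopologicalAddGroup E] [ContinuousSMul ℝ E]
      {E' : Type v} [AddCommGroup E'] [Module ℝ E'] [TopologicalSpace E']
      [IsTopologicalAddGroup E'] [ContinuousSMul ℝ E'] [T2Space E'] [FiniteDimensional ℝ E']
      {U : DenseIntSet E} {U' : DenseIntSet E'}
      (_ : LocallyCompactSpace U'.carrier ∨ TopologicalSpace.MetrizableSpace E)
      {g : U.carrier → SmoothMap U' F} (_ : IsCn n U g),
      IsCn n (U.prod U') (fun p => g ⟨p.1.1, p.2.1⟩ ⟨p.1.2, p.2.2⟩) := by
  induction n with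
  | zero =>
    intro E _ _ _ _ _ E' _ _ _ _ _ _ _ U U' h g hg
    exact (continuous_uncurry_smoothMap h hg).comp (Continuous.prodMk
      (Continuous.subtype_mk (by fun_prop) _) (Continuous.subtype_mk (by fun_prop) _))
  | succ n ih =>
    rintro E _ _ _ _ _ E' _ _ _ _ _ _ _ U U' h g ⟨dg, hg, hg'⟩
    refine ⟨_, hg.uncurry h, IsCn.add n _ _ _ ?_ ?_⟩
    · let A : (E × E') × (E × E') →L[ℝ] (E × E) × E' :=
        ⟨{ toFun := fun p => ((p.1.1, p.2.1), p.1.2)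
           map_add' := fun _ _ => rfl
           map_smul' := fun _ _ => rfl }, by fun_prop⟩
      refine (ih (h.imp_right fun (_ : TopologicalSpace.MetrizableSpace E) =>
        inferInstanceAs (TopologicalSpace.MetrizableSpace (E × E))) hg').comp n A
        (fun p (hp : p ∈ (U.prod U').tangent.carrier) => ⟨⟨hp.1.1, mem_univ _⟩, hp.1.2⟩)
        fun p hp => ?_
      rw [DenseIntSet.mem_interior_tangent, DenseIntSet.interior_prod] at hp
      rw [DenseIntSet.interior_prod]
      exact ⟨DenseIntSet.mem_interior_tangent.2 hp.1, hp.2⟩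
    · let A : (E × E') × (E × E') →L[ℝ] E × (E' × E') :=
        ⟨{ toFun := fun p => (p.1.1, (p.1.2, p.2.2))
           map_add' := fun _ _ => rfl
           map_smul' := fun _ _ => rfl }, by fun_prop⟩
      -- Composing with the continuous linear map `d` costs no order of differentiability.
      have hd : IsCn n U (fun x => SmoothMap.differential (g x)) :=
        (IsCn.of_succ n ⟨dg, hg, hg'⟩).map SmoothMap.differentialCLM n
      refine (ih (locallyCompactSpace_tangent_or_metrizableSpace h) hd).comp n A
        (fun p (hp : p ∈ (U.prod U').tangent.carrier) => ⟨hp.1.1, hp.1.2, mem_univ _⟩)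
        fun p hp => ?_
      rw [DenseIntSet.mem_interior_tangent, DenseIntSet.interior_prod] at hp
      rw [DenseIntSet.interior_prod]
      exact ⟨hp.1, DenseIntSet.mem_interior_tangent.2 hp.2⟩

theorem SmoothMap.curry_bijective {E : Type u} [AddCommGroup E] [Module ℝ E] [TopologicalSpace E]
    [IsTopologicalAddGroup E] [ContinuousSMul ℝ E]
    {E' : Type v} [AddCommGroup E'] [Module ℝ E'] [TopologicalSpace E']
    [IsTopologicalAddGroup E'] [ContinuousSMul ℝ E'] [T2Space E'] [FiniteDimensional ℝ E']
    {F : Type w} [AddCommGroup F] [Module ℝ F] [TopologicalSpace F]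
    [IsTopologicalAddGroup F] [ContinuousSMul ℝ F] [LocallyConvexSpace ℝ F] [T2Space F]
    {U : DenseIntSet E} {U' : DenseIntSet E'}
    (h : LocallyCompactSpace U'.carrier ∨ TopologicalSpace.MetrizableSpace E) :
    Function.Bijective (curry : SmoothMap (U.prod U') F →ₗ[ℝ] SmoothMap U (SmoothMap U' F)) := by
  constructor
  · intro f₁ f₂ hf
    refine Subtype.ext (funext fun p => ?_)
    exact congrFun (congrArg Subtype.val (congrFun (congrArg Subtype.val hf) ⟨p.1.1, p.2.1⟩))
      ⟨p.1.2, p.2.2⟩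
  · intro g
    exact ⟨⟨_, fun n => (g.smooth n).uncurry n h⟩, rfl⟩

/-- Currying is well defined on arbitrary sets with dense interior, and bijective if `E'` has finite
dimension and `U'` is locally compact or `E` is metrizable. The direct argument above covers the
sets with dense interior at once, so that the principle for open sets is not used. -/
theorem mainTheorem7
    (E : Type u) [AddCommGroup E] [Module ℝ E] [TopologicalSpace E]
    [IsTopologicalAddGroup E] [ContinuousSMul ℝ E] [LocallyConvexSpace ℝ E] [T2Space E]
    (E' : Type v) [AddCommGroup E'] [Module ℝ E'] [TopologicalSpace E']
    [IsTopologicalAddGroup E'] [ContinuousSMul ℝ E'] [LocallyConvexSpace ℝ E'] [T2Space E']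
    (hCCP : CartesianClosedness.{u, v, w} E E')
    (U : Set E) (hU : U ⊆ closure (interior U))
    (U' : Set E') (hU' : U' ⊆ closure (interior U'))
    (F : Type w) [AddCommGroup F] [Module ℝ F] [TopologicalSpace F]
    [IsTopologicalAddGroup F] [ContinuousSMul ℝ F] [LocallyConvexSpace ℝ F] [T2Space F] :
    ∃ Φ : SmoothMap (DenseIntSet.prod ⟨U, hU⟩ ⟨U', hU'⟩) F →ₗ[ℝ]
        SmoothMap (⟨U, hU⟩ : DenseIntSet E) (SmoothMap (⟨U', hU'⟩ : DenseIntSet E') F),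
      IsCurrying Φ ∧
        (FiniteDimensional ℝ E' → LocallyCompactSpace U' ∨ TopologicalSpace.MetrizableSpace E →
          Function.Bijective Φ) := by
  refine ⟨SmoothMap.curry, fun f x y => rfl, fun _ h => ?_⟩
  exact SmoothMap.curry_bijective h
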